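/- Let $E$, $F$ be finite-dimensional real vector spaces, and let $E_+\subseteq E$, $F_+\subseteq F$ be closed convex cones that are proper (that is, $E_+\cap -E_+=\{0\}$ and $F_+\cap -F_+=\{0\}$) and generating (that is, $E_+-E_+=E$ and $F_+-F_+=F$). Assume that each of $E_+$ and $F_+$ is one of the following (all combinations allowed, and kinds (b) and (c) taken up to linear isomorphism): (a) a polyhedral cone, i.e. an intersection of finitely many closed linear half-spaces; (b) a second-order (Lorentz) cone $\{x\in\mathbb{R}^n : \sqrt{x_1^2+\cdots+x_{n-1}^2}\le x_n\}$ with $n\ge 1$; (c) the cone of positive semidefinite matrices in the real vector space of real symmetric $n\times n$ matrices, or in the real vector space of complex Hermitian $n\times n$ matrices. Let $E_+^*\subseteq E^*$ and $F_+^*\subseteq F^*$ be the dual cones of nonnegative linear functionals. Let $$P:=\Big\{\sum_{i=1}^k x_i\otimes y_i : k\in\mathbb{N},\ x_i\in E_+,\ y_i\in F_+\Big\}\subseteq E\otimes F$$ be the projective cone and $$I:=\big\{u\in E\otimes F : \langle u,\varphi\otimes\psi\rangle\ge 0\ \text{for all }\varphi\in E_+^*,\ \psi\in F_+^*\big\}$$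 the injective cone. Then $P=I$ if and only if at least one of $E_+$ and $F_+$ is a simplex cone, i.e. is generated (as a convex cone) by a basis of the space in which it lies. -/

import Mathlib

open scoped ComplexOrder

/-- A convex cone `C` in a real vector space `E` is *proper* if `C ∩ -C = {0}`. -/
def IsProperCone {E : Type*} [AddCommGroup E] [Module ℝ E] (C : PointedCone ℝ E) : Prop :=
  ∀ x : E, x ∈ C → -x ∈ C → x = 0

/-- A convex cone `C` in a real vector space `E` is *generating* if `C - C = E`. -/
def IsGeneratingCone {E : Type*} [AddCommGroup E] [Module ℝ E] (C : PointedCone ℝ E) : Prop :=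
  ∀ x : E, ∃ y ∈ C, ∃ z ∈ C, x = y - z

/-- A *simplex cone* in a finite-dimensional space `E` is a convex cone that is generated by a
basis of `E`. -/
def IsSimplexCone {E : Type*} [AddCommGroup E] [Module ℝ E] (C : PointedCone ℝ E) : Prop :=
  ∃ (n : ℕ) (b : Module.Basis (Fin n) ℝ E), C = PointedCone.hull ℝ (Set.range b)

/-- A *polyhedral cone* in `E` is the intersection of finitely many closed linear half-spaces
`{x | 0 ≤ φ x}` with `φ` a linear functional. -/
def IsPolyhedralCone {E : Type*} [AddCommGroup E] [Module ℝ E] (C : PointedCone ℝ E) : Prop :=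
  ∃ s : Finset (Module.Dual ℝ E), ∀ x : E, x ∈ C ↔ ∀ φ ∈ s, 0 ≤ φ x

/-- The second-order cone (Lorentz cone) in `ℝ^(n+1)`: all `(x₀, …, xₙ)` with
`√(x₀² + ⋯ + xₙ₋₁²) ≤ xₙ`. For `n = 0` it is the half-line `ℝ≥0` in `ℝ`. -/
noncomputable def lorentzCone (n : ℕ) : PointedCone ℝ (Fin (n + 1) → ℝ) where
  carrier := {x | Real.sqrt (∑ i : Fin n, x i.castSucc ^ 2) ≤ x (Fin.last n)}
  zero_mem' := by simp
  add_mem' := by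
    intro x y hx hy
    have key : ∀ z : Fin (n + 1) → ℝ, Real.sqrt (∑ i : Fin n, z i.castSucc ^ 2) =
        ‖(WithLp.toLp 2 (fun i : Fin n => z i.castSucc) : EuclideanSpace ℝ (Fin n))‖ := by
      intro z
      simp [EuclideanSpace.norm_eq]
    simp only [Set.mem_ofPred_eq, key] at hx hy ⊢
    exact (norm_add_le (WithLp.toLp 2 (fun i : Fin n => x i.castSucc) : EuclideanSpace ℝ (Fin n))
      (WithLp.toLp 2 (fun i : Fin n => y i.castSucc))).trans (add_le_add hx hy)
  smul_mem' := by
    rintro ⟨c, hc⟩ x hx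
    simp only [Set.mem_ofPred_eq] at hx ⊢
    have h : ∑ i : Fin n, (c * x i.castSucc) ^ 2 = c ^ 2 * ∑ i : Fin n, x i.castSucc ^ 2 := by
      simp only [mul_pow, Finset.mul_sum]
    change Real.sqrt (∑ i : Fin n, (c * x i.castSucc) ^ 2) ≤ c * x (Fin.last n)
    rw [h, Real.sqrt_mul (sq_nonneg c), Real.sqrt_sq hc]
    exact mul_le_mul_of_nonneg_left hx hc

/-- The real vector space of self-adjoint `n × n` matrices over `𝕜`: the real symmetric matrices
if `𝕜 = ℝ`, the complex hermitian matrices if `𝕜 = ℂ`. -/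
abbrev HermMatrix (𝕜 : Type) [RCLike 𝕜] (n : ℕ) : Type :=
  ↥(selfAdjoint.submodule ℝ (Matrix (Fin n) (Fin n) 𝕜))

/-- The cone of positive semidefinite matrices in the real vector space of self-adjoint `n × n`
matrices over `𝕜`. -/
def psdCone (𝕜 : Type) [RCLike 𝕜] (n : ℕ) : PointedCone ℝ (HermMatrix 𝕜 n) where
  carrier := {A | (A : Matrix (Fin n) (Fin n) 𝕜).PosSemidef}
  zero_mem' := Matrix.PosSemidef.zero
  add_mem' := fun hA hB => Matrix.PosSemidef.add hA hB
  smul_mem' := fun c _ hA => Matrix.PosSemidef.smul hA c.2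

/-- Two convex cones are isomorphic if some linear isomorphism of the ambient spaces maps
one onto the other. -/
def ConeIso {E F : Type*} [AddCommGroup E] [Module ℝ E] [AddCommGroup F] [Module ℝ F]
    (C : PointedCone ℝ E) (D : PointedCone ℝ F) : Prop :=
  ∃ e : E ≃ₗ[ℝ] F, ∀ x : E, x ∈ C ↔ e x ∈ D

/-- A *standard cone*: a polyhedral cone, a second-order cone, or a real or complex positive
semidefinite cone, the latter two kinds up to linear isomorphism. -/
def IsStandardCone {E : Type*} [AddCommGroup E] [Module ℝ E] (C : PointedCone ℝ E) : Prop :=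
  IsPolyhedralCone C ∨
  (∃ n : ℕ, ConeIso C (lorentzCone n)) ∨
  (∃ n : ℕ, ConeIso C (psdCone ℝ n)) ∨
  (∃ n : ℕ, ConeIso C (psdCone ℂ n))

/-! ### Elements of the injective cone outside the projective cone. -/

section ConeTensor

open TensorProduct

/-! If one cone is a simplex cone, expanding a tensor along its basis and pairing with the dual
basis leaves coefficients in the bidual of the other cone, which is closed; hence `P = I`.

For the converse, a standard cone that is not a simplex cone contains one of two obstructions.
Second-order and semidefinite cones of small size are polyhedral; the others retract onto the cone
over a disc (`HasDisc`). A polyhedral cone that is not simplicial has a parallelogram with three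
sides on suitable supporting hyperplanes (`HasSquare`, by `polyCone_isSimplicial_or_hasSquare`). For
each pair of obstructions an explicit tensor lies in `I` but not in `P`.

Exclusion from `P` rests on `not_mem_minTensorProduct_of_zeros`: if nonnegative pairings vanish on a
sum of elementary tensors, they vanish on each term `x ⊗ y`. Were `B x` and `B' y` both nonzero,
then `K x = 0` and `K' y = 0`, while `A x = 0` or `A' y = 0`; so `B x = 0` or `B' y = 0` after all.

The polyhedral alternative is proved by induction on the number of inequalities. Facets and cones of
feasible directions need fewer, and squares lift from both (`HasSquare.of_face`,
`HasSquare.of_filter`). If all of these are simplicial, comparing the neighbors of a facet at two of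
its rays yields either an apex for the whole cone or a square. -/

/-- A certificate that an element with prescribed zeros is not in the minimal tensor product. -/
theorem not_mem_minTensorProduct_of_zeros
    {E F : Type*} [AddCommGroup E] [Module ℝ E] [AddCommGroup F] [Module ℝ F]
    {C : PointedCone ℝ E} {D : PointedCone ℝ F} (u : E ⊗[ℝ] F)
    (A B K : Module.Dual ℝ E) (A' B' K' : Module.Dual ℝ F)
    (hA : ∀ x ∈ C, 0 ≤ A x) (hB : ∀ x ∈ C, 0 ≤ B x) (hK : ∀ x ∈ C, 0 ≤ K x)
    (hA' : ∀ y ∈ D, 0 ≤ A' y) (hB' : ∀ y ∈ D, 0 ≤ B' y) (hK' : ∀ y ∈ D, 0 ≤ K' y)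
    (hC : ∀ x ∈ C, A x = 0 → K x = 0 → B x = 0)
    (hD : ∀ y ∈ D, A' y = 0 → K' y = 0 → B' y = 0)
    (hAA : TensorProduct.dualDistrib ℝ E F (A ⊗ₜ A') u = 0)
    (hKB : TensorProduct.dualDistrib ℝ E F (K ⊗ₜ B') u = 0)
    (hBK : TensorProduct.dualDistrib ℝ E F (B ⊗ₜ K') u = 0)
    (hBB : TensorProduct.dualDistrib ℝ E F (B ⊗ₜ B') u ≠ 0) :
    u ∉ PointedCone.minTensorProduct C D := by
  intro hu
  -- On the minimal tensor product, vanishing of the first three pairings forces the fourth.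
  have key : ∀ v ∈ PointedCone.minTensorProduct C D,
      (0 ≤ dualDistrib ℝ E F (A ⊗ₜ A') v ∧ 0 ≤ dualDistrib ℝ E F (K ⊗ₜ B') v ∧
        0 ≤ dualDistrib ℝ E F (B ⊗ₜ K') v) ∧
      (dualDistrib ℝ E F (A ⊗ₜ A') v = 0 → dualDistrib ℝ E F (K ⊗ₜ B') v = 0 →
        dualDistrib ℝ E F (B ⊗ₜ K') v = 0 → dualDistrib ℝ E F (B ⊗ₜ B') v = 0) := by
    intro v hv
    induction hv using Submodule.span_induction with
    | mem v hv =>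
      obtain ⟨x, hx, y, hy, rfl⟩ := hv
      simp only [dualDistrib_apply]
      refine ⟨⟨mul_nonneg (hA x hx) (hA' y hy), mul_nonneg (hK x hx) (hB' y hy),
        mul_nonneg (hB x hx) (hK' y hy)⟩, fun h1 h2 h3 => ?_⟩
      by_contra h
      obtain ⟨hb, hb'⟩ := mul_ne_zero_iff.mp h
      have hk : K x = 0 := (mul_eq_zero.mp h2).resolve_right hb'
      have hk' : K' y = 0 := (mul_eq_zero.mp h3).resolve_left hb
      rcases mul_eq_zero.mp h1 with h0 | h0
      · exact hb (hC x hx h0 hk)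
      · exact hb' (hD y hy h0 hk')
    | zero => simp
    | add v w _ _ hv hw =>
      obtain ⟨⟨a1, a2, a3⟩, a4⟩ := hv
      obtain ⟨⟨b1, b2, b3⟩, b4⟩ := hw
      simp only [map_add]
      refine ⟨⟨by linarith, by linarith, by linarith⟩, fun h1 h2 h3 => ?_⟩
      rw [a4 (by linarith) (by linarith) (by linarith), b4 (by linarith) (by linarith) (by linarith),
        add_zero]
    | smul c v _ hv =>
      obtain ⟨⟨a1, a2, a3⟩, a4⟩ := hv
      have hs : c • v = (c : ℝ) • v := rfl
      simp only [hs, map_smul, smul_eq_mul]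
      refine ⟨⟨mul_nonneg c.2 a1, mul_nonneg c.2 a2, mul_nonneg c.2 a3⟩, fun h1 h2 h3 => ?_⟩
      by_cases hc : (c : ℝ) = 0
      · simp [hc]
      · rw [a4 ((mul_eq_zero.mp h1).resolve_left hc) ((mul_eq_zero.mp h2).resolve_left hc)
          ((mul_eq_zero.mp h3).resolve_left hc), mul_zero]
  exact hBB ((key u hu).2 hAA hKB hBK)

/-- A parallelogram `w + z = x + p` inside `C`, three sides of which lie in the zero sets of
nonnegative functionals `A`, `B`, `K` such that `A` and `K` have no common zero off `ker B`. -/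
def HasSquare {E : Type*} [AddCommGroup E] [Module ℝ E] (C : Set E) : Prop :=
  ∃ w ∈ C, ∃ z ∈ C, ∃ x ∈ C, ∃ p ∈ C, ∃ A B K : Module.Dual ℝ E,
    (∀ c ∈ C, 0 ≤ A c) ∧ (∀ c ∈ C, 0 ≤ B c) ∧ (∀ c ∈ C, 0 ≤ K c) ∧
    w + z = x + p ∧ A x = 0 ∧ A w = 0 ∧ B x = 0 ∧ B z = 0 ∧ K z = 0 ∧ K p = 0 ∧ 0 < B p ∧
    ∀ c ∈ C, A c = 0 → K c = 0 → B c = 0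

theorem neg_le_and_le_of_sq_add_sq_le {t a b : ℝ} (h : 0 ≤ t ∧ a ^ 2 + b ^ 2 ≤ t ^ 2) :
    (-t ≤ a ∧ a ≤ t) ∧ (-t ≤ b ∧ b ≤ t) :=
  ⟨abs_le_of_sq_le_sq' (by nlinarith [h.2, sq_nonneg b]) h.1,
    abs_le_of_sq_le_sq' (by nlinarith [h.2, sq_nonneg a]) h.1⟩

/-- The cone over the unit disc is a retract of `C`. -/
def HasDisc {E : Type*} [AddCommGroup E] [Module ℝ E] (C : Set E) : Prop :=
  ∃ (e₀ e₁ e₂ : E) (T X Y : Module.Dual ℝ E),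
    (∀ c ∈ C, 0 ≤ T c ∧ X c ^ 2 + Y c ^ 2 ≤ T c ^ 2) ∧
    (∀ t a b : ℝ, 0 ≤ t → a ^ 2 + b ^ 2 ≤ t ^ 2 → t • e₀ + a • e₁ + b • e₂ ∈ C) ∧
    T e₀ = 1 ∧ T e₁ = 0 ∧ T e₂ = 0 ∧ X e₀ = 0 ∧ X e₁ = 1 ∧ X e₂ = 0 ∧
    Y e₀ = 0 ∧ Y e₁ = 0 ∧ Y e₂ = 1

section
variable {E F : Type*} [AddCommGroup E] [Module ℝ E] [AddCommGroup F] [Module ℝ F]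
  {C : PointedCone ℝ E} {D : PointedCone ℝ F}

/-- The number `d = φ w - φ p = φ x - φ z` lies between `-φ p` and `φ x`, and likewise `d'` for `ψ`.
Hence `d * d' ≤ φ p * ψ p' + φ x * ψ x'`, which is the positivity of the witness. -/
theorem minTensorProduct_ne_max_of_hasSquare (hC : HasSquare (C : Set E))
    (hD : HasSquare (D : Set F)) :
    PointedCone.minTensorProduct C D ≠ PointedCone.maxTensorProduct C D := by
  obtain ⟨w, hw, z, hz, x, hx, p, hp, A, B, K, hA, hB, hK, e, Ax, Aw, Bx, Bz, Kz, Kp, Bp, hs⟩ := hC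
  obtain ⟨w', hw', z', hz', x', hx', p', hp', A', B', K', hA', hB', hK', e', Ax', Aw', Bx', Bz',
    Kz', Kp', Bp', hs'⟩ := hD
  have eB : B w = B p := by have := congrArg B e; simp only [map_add] at this; linarith
  have eB' : B' w' = B' p' := by have := congrArg B' e'; simp only [map_add] at this; linarith
  intro h
  refine not_mem_minTensorProduct_of_zeros
    (C := C) (D := D) (p ⊗ₜ p' + x ⊗ₜ x' - (w - p) ⊗ₜ (w' - p')) A B K A' B' K'
    hA hB hK hA' hB' hK' hs hs' ?_ ?_ ?_ ?_ ?_
  · simp [dualDistrib_apply, Ax, Aw, Aw']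
  · simp [dualDistrib_apply, Kp, eB', Bx']
  · simp [dualDistrib_apply, Kp', eB, Bx]
  · simp [dualDistrib_apply, eB, Bx, Bp.ne', Bp'.ne']
  · rw [h, PointedCone.mem_maxTensorProduct]
    intro φ hφ ψ hψ
    have a1 : 0 ≤ φ w := hφ hw
    have a2 : 0 ≤ φ z := hφ hz
    have a3 : 0 ≤ φ x := hφ hx
    have a4 : 0 ≤ φ p := hφ hp
    have b1 : 0 ≤ ψ w' := hψ hw'
    have b2 : 0 ≤ ψ z' := hψ hz'
    have b3 : 0 ≤ ψ x' := hψ hx'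
    have b4 : 0 ≤ ψ p' := hψ hp'
    have ea : φ w + φ z = φ x + φ p := by rw [← map_add, e, map_add]
    have eb : ψ w' + ψ z' = ψ x' + ψ p' := by rw [← map_add, e', map_add]
    simp only [map_add, map_sub, dualDistrib_apply]
    rcases le_total (φ w) (φ p) with g | g <;> rcases le_total (ψ w') (ψ p') with g' | g'
    · nlinarith [mul_nonneg a3 b3, mul_nonneg a1 b4, mul_nonneg b1 (sub_nonneg.2 g)]
    · nlinarith [mul_nonneg a3 b3, mul_nonneg a4 b4, mul_nonneg (sub_nonneg.2 g) (sub_nonneg.2 g')]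
    · nlinarith [mul_nonneg a3 b3, mul_nonneg a4 b4, mul_nonneg (sub_nonneg.2 g) (sub_nonneg.2 g')]
    · have : (φ w - φ p) * (ψ w' - ψ p') ≤ φ x * ψ x' :=
        mul_le_mul (by linarith) (by linarith) (by linarith) a3
      nlinarith [mul_nonneg a4 b4]

theorem HasDisc.le_of_dual {C : Set E} {e₀ e₁ e₂ : E}
    (h : ∀ t a b : ℝ, 0 ≤ t → a ^ 2 + b ^ 2 ≤ t ^ 2 → t • e₀ + a • e₁ + b • e₂ ∈ C)
    (φ : Module.Dual ℝ E) (hφ : ∀ x ∈ C, 0 ≤ φ x) :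
    0 ≤ φ e₀ ∧ φ e₁ ^ 2 + φ e₂ ^ 2 ≤ φ e₀ ^ 2 := by
  have h0 : 0 ≤ φ e₀ := by simpa using hφ _ (h 1 0 0 zero_le_one (by norm_num))
  refine ⟨h0, ?_⟩
  -- The disc cone is self-dual: the test vector `(r, -φ e₁, -φ e₂)` is the equality case of
  -- Cauchy–Schwarz.
  set r := Real.sqrt (φ e₁ ^ 2 + φ e₂ ^ 2) with hr
  have hr2 : r ^ 2 = φ e₁ ^ 2 + φ e₂ ^ 2 := Real.sq_sqrt (by positivity)
  have hr0 : 0 ≤ r := Real.sqrt_nonneg _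
  have h1 := hφ _ (h r (-φ e₁) (-φ e₂) hr0 (by rw [hr2]; linarith))
  simp only [map_add, map_smul, smul_eq_mul] at h1
  rw [← hr2]
  rcases hr0.eq_or_lt with h' | h'
  · rw [← h', zero_pow two_ne_zero]; positivity
  · have : r ≤ φ e₀ := le_of_mul_le_mul_left (by nlinarith) h'
    gcongr

theorem minTensorProduct_ne_max_of_hasDisc_of_hasSquare (hC : HasDisc (C : Set E))
    (hD : HasSquare (D : Set F)) :
    PointedCone.minTensorProduct C D ≠ PointedCone.maxTensorProduct C D := by
  obtain ⟨e₀, e₁, e₂, T, X, Y, hT, he, T0, T1, T2, X0, X1, X2, Y0, Y1, Y2⟩ := hC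
  obtain ⟨w, hw, z, hz, x, hx, p, hp, A, B, K, hA, hB, hK, e, Ax, Aw, Bx, Bz, Kz, Kp, Bp, hs⟩ := hD
  have eB : B w = B p := by have := congrArg B e; simp only [map_add] at this; linarith
  have eA : A z = A p := by have := congrArg A e; simp only [map_add] at this; linarith
  have eK : K w = K x := by have := congrArg K e; simp only [map_add] at this; linarith
  intro h
  refine not_mem_minTensorProduct_of_zeros
    (C := C) (D := D) (e₀ ⊗ₜ (x + p) + e₁ ⊗ₜ (w - p) + e₂ ⊗ₜ (z - p)) (T + X) (T - X) (T + Y) A B K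
    ?_ ?_ ?_ hA hB hK ?_ hs ?_ ?_ ?_ ?_ ?_
  · intro c hc
    have := neg_le_and_le_of_sq_add_sq_le (hT c hc)
    simp only [LinearMap.add_apply]; linarith
  · intro c hc
    have := neg_le_and_le_of_sq_add_sq_le (hT c hc)
    simp only [LinearMap.sub_apply]; linarith
  · intro c hc
    have := neg_le_and_le_of_sq_add_sq_le (hT c hc)
    simp only [LinearMap.add_apply]; linarith
  · intro c hc h1 h2
    obtain ⟨-, h4⟩ := hT c hc
    simp only [LinearMap.add_apply, LinearMap.sub_apply] at h1 h2 ⊢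
    have hX : X c = - T c := by linarith
    have hY : Y c = - T c := by linarith
    rw [hX, hY] at h4
    have : T c = 0 := by nlinarith
    linarith
  · simp [dualDistrib_apply, Ax, Aw, T0, T1, T2, X0, X1, X2]
  · simp [dualDistrib_apply, Bz, Bx, eB, T0, T1, T2, Y0, Y1, Y2]
  · simp [dualDistrib_apply, Kp, Kz, eK, T0, T1, T2, X0, X1, X2]
  · simp [dualDistrib_apply, Bz, Bx, eB, T0, T1, T2, X0, X1, X2, Bp.ne']
  · rw [h, PointedCone.mem_maxTensorProduct]
    intro φ hφ ψ hψ
    obtain ⟨h1, h2⟩ := HasDisc.le_of_dual he φ (fun x hx => hφ hx)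
    obtain ⟨hX, hY⟩ := neg_le_and_le_of_sq_add_sq_le ⟨h1, h2⟩
    have b1 : 0 ≤ ψ w := hψ hw
    have b2 : 0 ≤ ψ z := hψ hz
    have b3 : 0 ≤ ψ x := hψ hx
    have b4 : 0 ≤ ψ p := hψ hp
    have eb : ψ w = ψ x + ψ p - ψ z := by rw [eq_sub_iff_add_eq, ← map_add, e, map_add]
    simp only [map_add, map_sub, dualDistrib_apply]
    generalize φ e₀ = t at *
    generalize φ e₁ = a at *
    generalize φ e₂ = b at *
    rcases h1.eq_or_lt with h0 | h0
    · have ha : a = 0 := by linarith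
      have hb : b = 0 := by linarith
      simp [← h0, ha, hb]
    -- Bilinear interpolation of `ψ` over the four corners of the square `[-t, t]²`, which contains
    -- the disc: the mixed term `a * b` cancels since `w + z = x + p`, and the sum of `k1` to `k4`
    -- is `2 * t` times the goal.
    · refine nonneg_of_mul_nonneg_right (a := t) ?_ h0
      have k1 := mul_nonneg (mul_nonneg (by linarith : 0 ≤ t + a) (by linarith : 0 ≤ t + b)) b3
      have k2 := mul_nonneg (mul_nonneg (by linarith : 0 ≤ t + a) (by linarith : 0 ≤ t - b)) b1
      have k3 := mul_nonneg (mul_nonneg (by linarith : 0 ≤ t - a) (by linarith : 0 ≤ t + b)) b2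
      have k4 := mul_nonneg (mul_nonneg (by linarith : 0 ≤ t - a) (by linarith : 0 ≤ t - b)) b4
      rw [eb] at k2 ⊢
      linarith

theorem minTensorProduct_ne_max_of_hasDisc (hC : HasDisc (C : Set E))
    (hD : HasDisc (D : Set F)) :
    PointedCone.minTensorProduct C D ≠ PointedCone.maxTensorProduct C D := by
  obtain ⟨e₀, e₁, e₂, T, X, Y, hT, he, T0, T1, T2, X0, X1, X2, Y0, Y1, Y2⟩ := hC
  obtain ⟨f₀, f₁, f₂, T', X', Y', hT', hf, T0', T1', T2', X0', X1', X2', Y0', Y1', Y2'⟩ := hD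
  intro h
  -- The tensor of the identity of the disc cone; its positivity is Cauchy–Schwarz. Antipodal
  -- functionals such as `T + X` and `T' - X'` pair to zero on it.
  refine not_mem_minTensorProduct_of_zeros
    (C := C) (D := D) (e₀ ⊗ₜ f₀ + e₁ ⊗ₜ f₁ + e₂ ⊗ₜ f₂) (T + X) (T - X) (T + Y)
    (T' - X') (T' - Y') (T' + X') ?_ ?_ ?_ ?_ ?_ ?_ ?_ ?_ ?_ ?_ ?_ ?_ ?_
  iterate 3
    intro c hc
    have := neg_le_and_le_of_sq_add_sq_le (hT c hc)
    simp only [LinearMap.add_apply, LinearMap.sub_apply]; linarith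
  iterate 3
    intro c hc
    have := neg_le_and_le_of_sq_add_sq_le (hT' c hc)
    simp only [LinearMap.add_apply, LinearMap.sub_apply]; linarith
  · intro c hc h1 h2
    obtain ⟨-, h4⟩ := hT c hc
    simp only [LinearMap.add_apply, LinearMap.sub_apply] at h1 h2 ⊢
    have hX : X c = - T c := by linarith
    have hY : Y c = - T c := by linarith
    rw [hX, hY] at h4
    have : T c = 0 := by nlinarith
    linarith
  · intro c hc h1 h2
    have := neg_le_and_le_of_sq_add_sq_le (hT' c hc)
    simp only [LinearMap.add_apply, LinearMap.sub_apply] at h1 h2 ⊢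
    linarith
  · simp [dualDistrib_apply, *]
  · simp [dualDistrib_apply, *]
  · simp [dualDistrib_apply, *]
  · simp [dualDistrib_apply, *]
  · rw [h, PointedCone.mem_maxTensorProduct]
    intro φ hφ ψ hψ
    obtain ⟨h1, h2⟩ := HasDisc.le_of_dual he φ (fun x hx => hφ hx)
    obtain ⟨h3, h4⟩ := HasDisc.le_of_dual hf ψ (fun x hx => hψ hx)
    simp only [map_add, dualDistrib_apply]
    have key : (φ e₁ * ψ f₁ + φ e₂ * ψ f₂) ^ 2 ≤ (φ e₀ * ψ f₀) ^ 2 := by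
      have := mul_le_mul h2 h4 (by positivity) (by positivity)
      nlinarith [sq_nonneg (φ e₁ * ψ f₂ - φ e₂ * ψ f₁)]
    have := (abs_le_of_sq_le_sq' key (mul_nonneg h1 h3)).1
    linarith

theorem minTensorProduct_eq_max_symm
    (h : PointedCone.minTensorProduct C D = PointedCone.maxTensorProduct C D) :
    PointedCone.minTensorProduct D C = PointedCone.maxTensorProduct D C := by
  rw [← PointedCone.minTensorProduct_comm, h, PointedCone.maxTensorProduct_comm]

end

end ConeTensor

/-! ### Farkas' lemma, faces and cones of feasible directions. -/

section Polyhedral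
variable {E : Type*} [AddCommGroup E] [Module ℝ E]

/-- **Farkas' lemma**: a functional that is nonnegative wherever finitely many functionals are
nonnegative is a conic combination of these. -/
theorem exists_nonneg_combination_of_forall_nonneg (n : ℕ) :
    ∀ (a : Fin n → Module.Dual ℝ E) (b : Module.Dual ℝ E),
      (∀ x, (∀ i, 0 ≤ a i x) → 0 ≤ b x) →
      ∃ l : Fin n → ℝ, (∀ i, 0 ≤ l i) ∧ b = ∑ i, l i • a i := by
  induction n with
  | zero =>
    intro a b h
    refine ⟨0, fun i => i.elim0, ?_⟩
    ext x
    have h1 := h x (fun i => i.elim0)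
    have h2 := h (-x) (fun i => i.elim0)
    rw [map_neg] at h2
    simp; linarith
  | succ n ih =>
    intro a b h
    by_cases hb : ∀ x, (∀ i : Fin n, 0 ≤ a i.castSucc x) → 0 ≤ b x
    · obtain ⟨l, hl, e⟩ := ih _ b hb
      refine ⟨Fin.snoc l 0, fun i => ?_, ?_⟩
      · refine Fin.lastCases ?_ (fun i => ?_) i <;> simp [hl]
      · simp [Fin.sum_univ_castSucc, e]
    · push Not at hb
      obtain ⟨q, hq, hbq⟩ := hb
      have hl : a (Fin.last n) q < 0 := by
        by_contra hc
        refine absurd (h q fun i => ?_) (not_le.2 hbq)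
        exact Fin.lastCases (not_lt.1 hc) hq i
      obtain ⟨x, hx, hbx, hlx⟩ : ∃ x, (∀ i : Fin n, 0 ≤ a i.castSucc x) ∧ b x < 0 ∧
          a (Fin.last n) x = -1 := by
        refine ⟨(-(a (Fin.last n) q))⁻¹ • q, fun i => ?_, ?_, ?_⟩
        · rw [map_smul, smul_eq_mul]
          exact mul_nonneg (inv_nonneg.2 (by linarith)) (hq i)
        · rw [map_smul, smul_eq_mul]
          exact mul_neg_of_pos_of_neg (inv_pos.2 (by linarith)) hbq
        · rw [map_smul, smul_eq_mul]
          rw [inv_neg, neg_mul, inv_mul_cancel₀ hl.ne]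
      -- The map `y ↦ y + a (Fin.last n) y • x` projects onto the kernel of the last functional; the
      -- induction hypothesis is applied to the pullbacks along it.
      obtain ⟨l, hl0, e⟩ := ih (fun i => a i.castSucc + a i.castSucc x • a (Fin.last n))
        (b + b x • a (Fin.last n)) (fun y hy => by
          have := h (y + a (Fin.last n) y • x) (fun i => by
            refine Fin.lastCases ?_ (fun i => ?_) i
            · simp [hlx]
            · have := hy i
              simp only [LinearMap.add_apply, LinearMap.smul_apply, smul_eq_mul, map_add,
                map_smul] at this ⊢
              linarith)
          simp only [LinearMap.add_apply, LinearMap.smul_apply, smul_eq_mul, map_add,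
            map_smul] at this ⊢
          linarith)
      refine ⟨Fin.snoc l (∑ i, l i * a i.castSucc x - b x), fun i => ?_, ?_⟩
      · refine Fin.lastCases ?_ (fun i => ?_) i
        · have := Finset.sum_nonneg fun i (_ : i ∈ Finset.univ) => mul_nonneg (hl0 i) (hx i)
          simp only [Fin.snoc_last]
          linarith
        · simp [hl0]
      · rw [eq_comm, ← sub_eq_iff_eq_add] at e
        ext y
        have := LinearMap.congr_fun e y
        simp only [LinearMap.sub_apply, LinearMap.sum_apply, LinearMap.smul_apply,
          LinearMap.add_apply, smul_eq_mul, mul_add, Finset.sum_add_distrib] at this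
        simp only [Fin.sum_univ_castSucc, Fin.snoc_castSucc, Fin.snoc_last, LinearMap.add_apply,
          LinearMap.sum_apply, LinearMap.smul_apply, smul_eq_mul, sub_mul, Finset.sum_mul]
        simp only [mul_assoc] at this ⊢
        linarith

/-- The polyhedral cone cut out of the subspace `V` by finitely many half-spaces. -/
def polyCone (V : Submodule ℝ E) (s : Finset (Module.Dual ℝ E)) : Set E :=
  {x | x ∈ V ∧ ∀ φ ∈ s, 0 ≤ φ x}

/-- A set is *simplicial* if it has a finite family of elements with a dual family of functionals
nonnegative on it that gives coordinates up to lineality. -/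
def IsSimplicialUpToLineality (C : Set E) : Prop :=
  ∃ (n : ℕ) (v : Fin n → E) (f : Fin n → Module.Dual ℝ E),
    (∀ i, v i ∈ C) ∧ (∀ i, ∀ c ∈ C, 0 ≤ f i c) ∧ (∀ i j, f i (v j) = if i = j then 1 else 0) ∧
    ∀ c ∈ C, c - ∑ i, f i c • v i ∈ C ∧ -(c - ∑ i, f i c • v i) ∈ C

variable {V : Submodule ℝ E} {s : Finset (Module.Dual ℝ E)}

theorem polyCone_add {x y : E} (hx : x ∈ polyCone V s) (hy : y ∈ polyCone V s) :
    x + y ∈ polyCone V s :=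
  ⟨V.add_mem hx.1 hy.1, fun φ h => by rw [map_add]; exact add_nonneg (hx.2 φ h) (hy.2 φ h)⟩

theorem polyCone_smul {x : E} {r : ℝ} (hr : 0 ≤ r) (hx : x ∈ polyCone V s) :
    r • x ∈ polyCone V s :=
  ⟨V.smul_mem _ hx.1, fun φ h => by
    rw [map_smul, smul_eq_mul]; exact mul_nonneg hr (hx.2 φ h)⟩

theorem polyCone_sum {ι : Type*} {t : Finset ι} {g : ι → E} (h : ∀ i ∈ t, g i ∈ polyCone V s) :
    ∑ i ∈ t, g i ∈ polyCone V s :=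
  ⟨V.sum_mem fun i hi => (h i hi).1, fun φ hφ => by
    rw [map_sum]; exact Finset.sum_nonneg fun i hi => (h i hi).2 φ hφ⟩

/-- A point at which all the defining functionals are positive is a relative interior point. -/
theorem exists_add_smul_mem_polyCone {g x : E} (hg : g ∈ V) (hs : ∀ φ ∈ s, 0 < φ g) (hx : x ∈ V) :
    ∃ ε : ℝ, 0 < ε ∧ g + ε • x ∈ polyCone V s := by
  obtain ⟨ε, hε, h⟩ : ∃ ε : ℝ, 0 < ε ∧ ∀ φ ∈ s, ε * |φ x| ≤ φ g := by
    classical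
    induction s using Finset.induction_on with
    | empty => exact ⟨1, one_pos, by simp⟩
    | insert φ t _ ih =>
      obtain ⟨ε, hε, h⟩ := ih fun ψ hψ => hs ψ (Finset.mem_insert_of_mem hψ)
      have hp := hs φ (Finset.mem_insert_self _ _)
      refine ⟨min ε (φ g / (|φ x| + 1)), by positivity, fun ψ hψ => ?_⟩
      rcases Finset.mem_insert.1 hψ with rfl | hψ
      · calc _ ≤ (ψ g / (|ψ x| + 1)) * (|ψ x| + 1) := by gcongr <;> simp
          _ = ψ g := by field_simp
      · exact (mul_le_mul_of_nonneg_right (min_le_left _ _) (abs_nonneg _)).trans (h ψ hψ)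
  refine ⟨ε, hε, V.add_mem hg (V.smul_mem _ hx), fun φ hφ => ?_⟩
  rw [map_add, map_smul, smul_eq_mul]
  nlinarith [h φ hφ, neg_abs_le (φ x)]

theorem sub_mem_polyCone_sub {g x : E} (hg : g ∈ V) (hs : ∀ φ ∈ s, 0 < φ g) (hx : x ∈ V) :
    ∃ a ∈ polyCone V s, ∃ b ∈ polyCone V s, x = a - b := by
  obtain ⟨ε, hε, h⟩ := exists_add_smul_mem_polyCone hg hs hx
  refine ⟨_, polyCone_smul (inv_nonneg.2 hε.le) h, _,
    polyCone_smul (inv_nonneg.2 hε.le) ⟨hg, fun φ h => (hs φ h).le⟩, ?_⟩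
  rw [smul_add, smul_smul, inv_mul_cancel₀ hε.ne', one_smul]
  abel

open Classical in
/-- A functional that is nonnegative on a face extends, modulo a multiple of the functional that
exposes the face, to a functional that is nonnegative on the cone. -/
theorem exists_add_smul_nonneg_polyCone {φ : Module.Dual ℝ E} (hφ : φ ∈ s) (A : Module.Dual ℝ E)
    (hA : ∀ x ∈ polyCone (V ⊓ LinearMap.ker φ) (s.erase φ), 0 ≤ A x) :
    ∃ N : ℝ, 0 ≤ N ∧ ∀ x ∈ polyCone V s, 0 ≤ A x + N * φ x := by
  -- Adjoining `-φ` to the constraints cuts out the face; its Farkas coefficient is the required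
  -- `N`.
  let a : Fin (s.card + 1) → Module.Dual ℝ V :=
    Fin.snoc (fun i => ((s.equivFin.symm i : s) : Module.Dual ℝ E) ∘ₗ V.subtype)
      (-(φ ∘ₗ V.subtype))
  obtain ⟨l, hl, e⟩ := exists_nonneg_combination_of_forall_nonneg _ a (A ∘ₗ V.subtype)
    (fun x hx => by
      have h1 : ∀ ψ ∈ s, 0 ≤ ψ x := fun ψ hψ => by
        simpa [a] using hx (s.equivFin ⟨ψ, hψ⟩).castSucc
      have h2 : 0 ≤ -(φ x) := by simpa [a] using hx (Fin.last _)
      have h3 := h1 φ hφ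
      exact hA x ⟨⟨x.2, LinearMap.mem_ker.2 (by linarith)⟩,
        fun ψ hψ => h1 ψ (Finset.mem_of_mem_erase hψ)⟩)
  refine ⟨l (Fin.last _), hl _, fun x hx => ?_⟩
  have e' := LinearMap.congr_fun e ⟨x, hx.1⟩
  simp only [a, Fin.sum_univ_castSucc, Fin.snoc_castSucc, Fin.snoc_last, LinearMap.add_apply,
    LinearMap.sum_apply, LinearMap.smul_apply, smul_eq_mul, LinearMap.comp_apply,
    Submodule.subtype_apply, LinearMap.neg_apply] at e'
  rw [e']
  have : 0 ≤ ∑ i : Fin s.card, l i.castSucc * ((s.equivFin.symm i : s) : Module.Dual ℝ E) x :=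
    Finset.sum_nonneg fun i _ => mul_nonneg (hl _) (hx.2 _ (s.equivFin.symm i).2)
  linarith

-- The extra `1` in `(N₁ + 1) • φ` makes every zero of the extended `A` in the cone a zero of `φ`,
-- so the common zeros of `A` and `K` fall back into the face.
open Classical in
theorem HasSquare.of_face {φ : Module.Dual ℝ E} (hφ : φ ∈ s)
    (h : HasSquare (polyCone (V ⊓ LinearMap.ker φ) (s.erase φ))) : HasSquare (polyCone V s) := by
  have sub : ∀ {c}, c ∈ polyCone (V ⊓ LinearMap.ker φ) (s.erase φ) →
      c ∈ polyCone V s ∧ φ c = 0 := by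
    intro c hc
    have h0 : φ c = 0 := hc.1.2
    refine ⟨⟨hc.1.1, fun ψ hψ => ?_⟩, h0⟩
    by_cases e : ψ = φ
    · rw [e, h0]
    · exact hc.2 ψ (Finset.mem_erase.2 ⟨e, hψ⟩)
  obtain ⟨w, hw, z, hz, x, hx, p, hp, A, B, K, hA, hB, hK, e, Ax, Aw, Bx, Bz, Kz, Kp, Bp, hs⟩ := h
  obtain ⟨hw, w0⟩ := sub hw
  obtain ⟨hz, z0⟩ := sub hz
  obtain ⟨hx, x0⟩ := sub hx
  obtain ⟨hp, p0⟩ := sub hp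
  obtain ⟨N₁, hN₁, hA⟩ := exists_add_smul_nonneg_polyCone hφ A hA
  obtain ⟨N₂, hN₂, hB⟩ := exists_add_smul_nonneg_polyCone hφ B hB
  obtain ⟨N₃, hN₃, hK⟩ := exists_add_smul_nonneg_polyCone hφ K hK
  refine ⟨w, hw, z, hz, x, hx, p, hp, A + (N₁ + 1) • φ, B + N₂ • φ, K + N₃ • φ, ?_, ?_, ?_, e,
    ?_, ?_, ?_, ?_, ?_, ?_, ?_, ?_⟩
  · intro c hc
    have := hA c hc
    have := hc.2 φ hφ
    simp only [LinearMap.add_apply, LinearMap.smul_apply, smul_eq_mul]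
    linarith
  · exact fun c hc => by simpa using hB c hc
  · exact fun c hc => by simpa using hK c hc
  iterate 6 simp [*]
  · simpa [p0] using Bp
  · intro c hc h1 h2
    have h3 := hA c hc
    have h4 := hc.2 φ hφ
    simp only [LinearMap.add_apply, LinearMap.smul_apply, smul_eq_mul] at h1 h2 ⊢
    have h5 : φ c = 0 := by linarith
    rw [h5, mul_zero, add_zero] at h1 h2 ⊢
    exact hs c ⟨⟨hc.1, h5⟩, fun ψ hψ => hc.2 ψ (Finset.mem_of_mem_erase hψ)⟩ h1 h2

/-- Every point of the cone `C + ℝ v` can be moved into `C` along `v`. -/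
theorem exists_add_smul_mem_of_filter {v : E} (hv : v ∈ polyCone V s) {c : E}
    (hc : c ∈ polyCone V (s.filter fun φ => φ v = 0)) :
    ∃ N : ℝ, 0 ≤ N ∧ ∀ M, N ≤ M → c + M • v ∈ polyCone V s := by
  obtain ⟨N, hN, h⟩ : ∃ N : ℝ, 0 ≤ N ∧ ∀ φ ∈ s, φ v ≠ 0 → 0 ≤ φ c + N * φ v := by
    refine ⟨∑ φ ∈ s, |φ c / φ v|, by positivity, fun φ hφ h0 => ?_⟩
    have hp : 0 < φ v := (hv.2 φ hφ).lt_of_ne' h0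
    have h1 : |φ c / φ v| ≤ ∑ φ ∈ s, |φ c / φ v| :=
      Finset.single_le_sum (f := fun φ : Module.Dual ℝ E => |φ c / φ v|)
        (fun _ _ => abs_nonneg _) hφ
    have h2 : -(φ c / φ v) * φ v ≤ (∑ φ ∈ s, |φ c / φ v|) * φ v :=
      mul_le_mul_of_nonneg_right ((neg_le_abs _).trans h1) hp.le
    rw [neg_mul, div_mul_cancel₀ _ h0] at h2
    linarith
  refine ⟨N, hN, fun M hM => ⟨V.add_mem hc.1 (V.smul_mem _ hv.1), fun φ hφ => ?_⟩⟩
  rw [map_add, map_smul, smul_eq_mul]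
  by_cases h0 : φ v = 0
  · rw [h0, mul_zero, add_zero]; exact hc.2 φ (Finset.mem_filter.2 ⟨hφ, h0⟩)
  · have := h φ hφ h0
    have := mul_le_mul_of_nonneg_right hM (hv.2 φ hφ)
    linarith

/-- Dropping the constraints positive at `v` produces `C + ℝ v`. Nonnegative functionals there
vanish at `v`, so shifting all four vertices by the same large multiple of `v` brings the square
into `C` and keeps every relation. -/
theorem HasSquare.of_filter {v : E} (hv : v ∈ polyCone V s)
    (h : HasSquare (polyCone V (s.filter fun φ => φ v = 0))) : HasSquare (polyCone V s) := by
  have sub : ∀ {c}, c ∈ polyCone V s → c ∈ polyCone V (s.filter fun φ => φ v = 0) :=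
    fun hc => ⟨hc.1, fun φ hφ => hc.2 φ (Finset.mem_filter.1 hφ).1⟩
  have lin : ∀ M : ℝ, M • v ∈ polyCone V (s.filter fun φ => φ v = 0) := fun M =>
    ⟨V.smul_mem _ hv.1, fun φ hφ => by simp [(Finset.mem_filter.1 hφ).2]⟩
  have van : ∀ A : Module.Dual ℝ E,
      (∀ c ∈ polyCone V (s.filter fun φ => φ v = 0), 0 ≤ A c) → A v = 0 := by
    intro A hA
    have h1 := hA _ (lin 1)
    have h2 := hA _ (lin (-1))
    simp at h1 h2
    linarith
  obtain ⟨w, hw, z, hz, x, hx, p, hp, A, B, K, hA, hB, hK, e, Ax, Aw, Bx, Bz, Kz, Kp, Bp, hs⟩ := h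
  obtain ⟨N₁, hN₁, hw⟩ := exists_add_smul_mem_of_filter hv hw
  obtain ⟨N₂, hN₂, hz⟩ := exists_add_smul_mem_of_filter hv hz
  obtain ⟨N₃, hN₃, hx⟩ := exists_add_smul_mem_of_filter hv hx
  obtain ⟨N₄, hN₄, hp⟩ := exists_add_smul_mem_of_filter hv hp
  set N := N₁ + N₂ + N₃ + N₄
  have := van A hA
  have := van B hB
  have := van K hK
  refine ⟨_, hw N (by linarith), _, hz N (by linarith), _, hx N (by linarith), _,
    hp N (by linarith), A, B, K, fun c hc => hA c (sub hc), fun c hc => hB c (sub hc),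
    fun c hc => hK c (sub hc), ?_, ?_, ?_, ?_, ?_, ?_, ?_, ?_, fun c hc => hs c (sub hc)⟩
  · rw [add_add_add_comm, e, add_add_add_comm]
  all_goals simp [*]

end Polyhedral

/-! ### Polyhedral cones: simplicial or containing a square. -/

section Polyhedral
variable {E : Type*} [AddCommGroup E] [Module ℝ E]
  {V : Submodule ℝ E} {s : Finset (Module.Dual ℝ E)}

theorem eq_zero_of_nonneg_of_neg_mem {C : Set E} {A : Module.Dual ℝ E} (hA : ∀ c ∈ C, 0 ≤ A c)
    {l : E} (h : l ∈ C) (h' : -l ∈ C) : A l = 0 := by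
  have h1 := hA _ h
  have h2 := hA _ h'
  rw [map_neg] at h2
  linarith

open Classical in
theorem mem_polyCone_face {B : Module.Dual ℝ E} {x : E} (hx : x ∈ polyCone V s) (h : B x = 0) :
    x ∈ polyCone (V ⊓ LinearMap.ker B) (s.erase B) :=
  ⟨⟨hx.1, h⟩, fun φ hφ => hx.2 φ (Finset.mem_of_mem_erase hφ)⟩

open Classical in
theorem mem_polyCone_of_face {B : Module.Dual ℝ E} {x : E}
    (hx : x ∈ polyCone (V ⊓ LinearMap.ker B) (s.erase B)) : x ∈ polyCone V s ∧ B x = 0 := by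
  have h0 : B x = 0 := hx.1.2
  refine ⟨⟨hx.1.1, fun φ hφ => ?_⟩, h0⟩
  by_cases e : φ = B
  · rw [e, h0]
  · exact hx.2 φ (Finset.mem_erase.2 ⟨e, hφ⟩)

/-- A simplicial facet together with one further point and suitable functionals yields a
simplicial cone. -/
theorem IsSimplicialUpToLineality.of_facet {C : Set E} {B : Module.Dual ℝ E} {m : ℕ}
    {v : Fin m → E} {f F : Fin m → Module.Dual ℝ E} {q : E}
    (hv : ∀ i, v i ∈ C) (hBv : ∀ i, B (v i) = 0) (hB : ∀ c ∈ C, 0 ≤ B c)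
    (hq : q ∈ C) (hBq : B q = 1)
    (hf : ∀ c ∈ C, ∀ x, x = c - B c • q →
      x - ∑ i, f i x • v i ∈ C ∧ -(x - ∑ i, f i x • v i) ∈ C)
    (hF : ∀ i, ∀ c ∈ C, 0 ≤ F i c) (hFv : ∀ i j, F i (v j) = if i = j then 1 else 0)
    (hFq : ∀ i, F i q = 0) : IsSimplicialUpToLineality C := by
  refine ⟨m + 1, Fin.snoc v q, Fin.snoc F B, fun i => ?_, fun i => ?_, fun i j => ?_, ?_⟩
  · refine Fin.lastCases ?_ (fun i => ?_) i <;> simp [hq, hv]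
  · refine Fin.lastCases ?_ (fun i => ?_) i <;> simp only [Fin.snoc_last, Fin.snoc_castSucc]
    exacts [hB, hF i]
  · refine Fin.lastCases ?_ (fun i => ?_) i <;> refine Fin.lastCases ?_ (fun j => ?_) j
    · simp [hBq]
    · simp [hBv, (Fin.castSucc_lt_last j).ne']
    · simp [hFq, (Fin.castSucc_lt_last i).ne]
    · simp [hFv]
  · intro c hc
    have h := hf c hc _ rfl
    have e : c - ∑ i : Fin (m + 1), (Fin.snoc F B : Fin (m + 1) → Module.Dual ℝ E) i c •
        (Fin.snoc v q : Fin (m + 1) → E) i =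
        (c - B c • q) - ∑ i, f i (c - B c • q) • v i := by
      rw [Fin.sum_univ_castSucc]
      simp only [Fin.snoc_last, Fin.snoc_castSucc]
      have : ∀ i, F i c = f i (c - B c • q) := by
        intro i
        have := eq_zero_of_nonneg_of_neg_mem (hF i) h.1 h.2
        simp only [map_sub, map_sum, map_smul, smul_eq_mul, hFv, hFq, mul_ite, mul_one, mul_zero,
          Finset.sum_ite_eq, Finset.mem_univ, if_true, sub_zero] at this ⊢
        linarith
      simp only [this]
      abel
    rw [e]
    exact h

open Classical in
/-- If `C + ℝ v` is simplicial, there is essentially one extreme ray of it off the facet. -/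
theorem exists_neighbor {B : Module.Dual ℝ E} (hBs : B ∈ s) {v g c₀ : E} (hv : v ∈ polyCone V s)
    (hBv : B v = 0) (hg : g ∈ V) (hBg : B g = 0) (hgs : ∀ φ ∈ s.erase B, 0 < φ g)
    (hc₀ : c₀ ∈ polyCone V s) (hBc : 0 < B c₀)
    (h : IsSimplicialUpToLineality (polyCone V (s.filter fun φ => φ v = 0))) :
    ∃ y ∈ polyCone V s, B y = 1 ∧ ∀ c ∈ polyCone V s, ∃ t : ℝ,
      c - B c • y + t • v ∈ polyCone (V ⊓ LinearMap.ker B) (s.erase B) := by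
  obtain ⟨n, u, h, hu, hh, hd, hL⟩ := h
  have sub : ∀ {c}, c ∈ polyCone V s → c ∈ polyCone V (s.filter fun φ => φ v = 0) :=
    fun hc => ⟨hc.1, fun φ hφ => hc.2 φ (Finset.mem_filter.1 hφ).1⟩
  have hB1 : ∀ c ∈ polyCone V (s.filter fun φ => φ v = 0), 0 ≤ B c :=
    fun c hc => hc.2 B (Finset.mem_filter.2 ⟨hBs, hBv⟩)
  have hBsum : ∀ c ∈ polyCone V s, B c = ∑ i, h i c * B (u i) := by
    intro c hc
    have := eq_zero_of_nonneg_of_neg_mem hB1 (hL c (sub hc)).1 (hL c (sub hc)).2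
    simp only [map_sub, map_sum, map_smul, smul_eq_mul] at this
    linarith
  have hG : ∀ x, x ∈ polyCone (V ⊓ LinearMap.ker B) (s.erase B) → x ∈ polyCone V s :=
    fun x hx => (mem_polyCone_of_face hx).1
  have hgC : g ∈ polyCone V s := hG g ⟨⟨hg, hBg⟩, fun φ hφ => (hgs φ hφ).le⟩
  obtain ⟨k, hk⟩ : ∃ k, 0 < B (u k) := by
    by_contra! hc
    have : ∀ i, B (u i) = 0 := fun i => le_antisymm (hc i) (hB1 _ (hu i))
    rw [hBsum c₀ hc₀] at hBc
    simp [this] at hBc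
  have hj : ∀ j, j ≠ k → B (u j) = 0 := by
    intro j hjk
    by_contra hne
    have hpos : 0 < B (u j) := (hB1 _ (hu j)).lt_of_ne' hne
    -- If `B` were positive on two rays, a combination of them would be a direction inside `ker B`.
    -- A small step from the relatively interior point `g` of the facet stays in the cone, yet makes
    -- `h k` negative, because `h k g = 0`.
    have hd0 : -(B (u j) • u k - B (u k) • u j) ∈ V ⊓ LinearMap.ker B := by
      refine ⟨V.neg_mem (V.sub_mem (V.smul_mem _ (hu k).1) (V.smul_mem _ (hu j).1)), ?_⟩
      refine LinearMap.mem_ker.2 ?_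
      simp; ring
    obtain ⟨ε, hε, hm⟩ := exists_add_smul_mem_polyCone (V := V ⊓ LinearMap.ker B) ⟨hg, hBg⟩ hgs hd0
    have h1 := hh k _ (sub (hG _ hm))
    have h2 : h k g = 0 := by
      have h3 : ∑ i, h i g * B (u i) = 0 := by rw [← hBsum g hgC, hBg]
      have h4 := (Finset.sum_eq_zero_iff_of_nonneg fun i _ =>
        mul_nonneg (hh i g (sub hgC)) (hB1 _ (hu i))).1 h3 k (Finset.mem_univ _)
      exact (mul_eq_zero.1 h4).resolve_right hk.ne'
    simp only [map_add, map_smul, map_neg, map_sub, hd, h2, if_true, if_neg hjk.symm,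
      smul_eq_mul] at h1
    nlinarith [mul_pos hε hpos]
  obtain ⟨N, -, hN⟩ := exists_add_smul_mem_of_filter hv (hu k)
  refine ⟨(B (u k))⁻¹ • (u k + N • v), polyCone_smul (inv_nonneg.2 hk.le) (hN N le_rfl), ?_, ?_⟩
  · simp [hBv, hk.ne']
  · intro c hc
    have hBc : B c = h k c * B (u k) := by
      rw [hBsum c hc, Finset.sum_eq_single k (fun j _ hjk => by rw [hj j hjk, mul_zero]) (by simp)]
    have he : c - h k c • u k ∈ polyCone V (s.filter fun φ => φ v = 0) := by
      have : c - h k c • u k = (c - ∑ i, h i c • u i) +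
          ∑ i ∈ Finset.univ.erase k, h i c • u i := by
        rw [← Finset.add_sum_erase _ _ (Finset.mem_univ k)]
        abel
      rw [this]
      exact polyCone_add (hL c (sub hc)).1
        (polyCone_sum fun i _ => polyCone_smul (hh i c (sub hc)) (hu i))
    obtain ⟨M, -, hM⟩ := exists_add_smul_mem_of_filter hv he
    refine ⟨M + h k c * N, ?_⟩
    have e : c - B c • (B (u k))⁻¹ • (u k + N • v) + (M + h k c * N) • v =
        c - h k c • u k + M • v := by
      rw [smul_smul, hBc, mul_assoc, mul_inv_cancel₀ hk.ne', mul_one]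
      module
    rw [e]
    refine mem_polyCone_face (hM M le_rfl) ?_
    simp [hBv, hBc]

/-- A cone with a simplicial facet spanned by at least two rays, such that two of the vertex
figures at this facet have a unique neighbor, is simplicial or contains a square. -/
theorem isSimplicial_or_hasSquare_of_neighbors {B : Module.Dual ℝ E} (hBs : B ∈ s) {k : ℕ}
    {v : Fin (k + 2) → E} {f : Fin (k + 2) → Module.Dual ℝ E}
    (hv : ∀ i, v i ∈ polyCone V s) (hBv : ∀ i, B (v i) = 0)
    (hfv : ∀ i j, f i (v j) = if i = j then 1 else 0)
    (hf : ∀ x ∈ V, B x = 0 → x - ∑ i, f i x • v i ∈ polyCone V s ∧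
      -(x - ∑ i, f i x • v i) ∈ polyCone V s)
    {y₀ y₁ : E} (hy₀ : y₀ ∈ polyCone V s) (hy₁ : y₁ ∈ polyCone V s)
    (hB₀ : B y₀ = 1) (hB₁ : B y₁ = 1)
    (hf₀ : ∀ j, j ≠ 0 → ∀ c ∈ polyCone V s, 0 ≤ f j c - B c * f j y₀)
    (hf₁ : ∀ j, j ≠ 1 → ∀ c ∈ polyCone V s, 0 ≤ f j c - B c * f j y₁) :
    IsSimplicialUpToLineality (polyCone V s) ∨ HasSquare (polyCone V s) := by
  have hB : ∀ c ∈ polyCone V s, 0 ≤ B c := fun c hc => hc.2 B hBs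
  let A₀ : Module.Dual ℝ E := ∑ j ∈ Finset.univ.erase 0, (f j - f j y₀ • B)
  -- `A₀` vanishes at `v 0` and `y₀`, and `A₁` at `v 1` and `y₁`: these are the opposite sides `A`,
  -- `K` of the prospective square, with `B` as the side between them.
  let A₁ : Module.Dual ℝ E := ∑ j ∈ Finset.univ.erase 1, (f j - f j y₁ • B)
  have ap : ∀ (y : E) (j : Fin (k + 2)) (c : E),
      (f j - f j y • B) c = f j c - B c * f j y := by
    intro y j c
    simp [mul_comm]
  have hA₀ : ∀ c ∈ polyCone V s, 0 ≤ A₀ c := fun c hc => by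
    simp only [A₀, LinearMap.sum_apply, ap]
    exact Finset.sum_nonneg fun j hj => hf₀ j (Finset.ne_of_mem_erase hj) c hc
  have hA₁ : ∀ c ∈ polyCone V s, 0 ≤ A₁ c := fun c hc => by
    simp only [A₁, LinearMap.sum_apply, ap]
    exact Finset.sum_nonneg fun j hj => hf₁ j (Finset.ne_of_mem_erase hj) c hc
  by_cases hs : ∀ c ∈ polyCone V s, A₀ c = 0 → A₁ c = 0 → B c = 0
  · right
    have hdV : y₀ - y₁ ∈ V := V.sub_mem hy₀.1 hy₁.1
    have hdB : B (y₀ - y₁) = 0 := by rw [map_sub, hB₀, hB₁, sub_self]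
    obtain ⟨hl, hl'⟩ := hf _ hdV hdB
    -- The two sign conditions kill all coordinates of `y₀ - y₁` except those along `v 0` and `v 1`,
    -- whose signs make `y₀ - f 1 (y₀ - y₁) • v 1 = y₁ + f 0 (y₀ - y₁) • v 0`, up to lineality, a
    -- parallelogram.
    have c0 : ∀ j, j ≠ 0 → f j (y₀ - y₁) ≤ 0 := fun j hj => by
      have := hf₀ j hj y₁ hy₁
      rw [map_sub]; rw [hB₁] at this; linarith
    have c1 : ∀ j, j ≠ 1 → 0 ≤ f j (y₀ - y₁) := fun j hj => by
      have := hf₁ j hj y₀ hy₀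
      rw [map_sub]; rw [hB₀] at this; linarith
    have hsum : ∑ i, f i (y₀ - y₁) • v i = f 0 (y₀ - y₁) • v 0 + f 1 (y₀ - y₁) • v 1 := by
      rw [Fin.sum_univ_succ, Fin.sum_univ_succ, Finset.sum_eq_zero, add_zero]
      · rfl
      · intro i _
        have : f i.succ.succ (y₀ - y₁) = 0 :=
          le_antisymm (c0 _ (Fin.succ_ne_zero _)) (c1 _ (by simp [Fin.ext_iff]))
        rw [this, zero_smul]
    rw [hsum] at hl hl'
    set l := y₀ - y₁ - (f 0 (y₀ - y₁) • v 0 + f 1 (y₀ - y₁) • v 1) with hl_def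
    have A₀l : A₀ (-l) = 0 := by rw [map_neg, eq_zero_of_nonneg_of_neg_mem hA₀ hl hl', neg_zero]
    have A₀y : A₀ y₀ = 0 := by simp [A₀, LinearMap.sum_apply, hB₀]
    have A₁y : A₁ y₁ = 0 := by simp [A₁, LinearMap.sum_apply, hB₁]
    have A₀v : A₀ (v 0) = 0 := by
      simp only [A₀, LinearMap.sum_apply, ap, hBv, hfv, zero_mul, sub_zero]
      exact Finset.sum_eq_zero fun j hj => if_neg (Finset.ne_of_mem_erase hj)
    have A₁v : A₁ (v 1) = 0 := by
      simp only [A₁, LinearMap.sum_apply, ap, hBv, hfv, zero_mul, sub_zero]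
      exact Finset.sum_eq_zero fun j hj => if_neg (Finset.ne_of_mem_erase hj)
    refine ⟨y₀ + -l, polyCone_add hy₀ hl', (-f 1 (y₀ - y₁)) • v 1,
      polyCone_smul (neg_nonneg.2 (c0 1 (by simp))) (hv 1), f 0 (y₀ - y₁) • v 0,
      polyCone_smul (c1 0 (by simp)) (hv 0), y₁, hy₁, A₀, B, A₁, hA₀, hB, hA₁, ?_, ?_, ?_, ?_, ?_,
      ?_, A₁y, by rw [hB₁]; exact one_pos, hs⟩
    · rw [hl_def]; module
    · rw [map_smul, A₀v, smul_zero]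
    · rw [map_add, A₀y, A₀l, add_zero]
    · rw [map_smul, hBv, smul_zero]
    · rw [map_smul, hBv, smul_zero]
    · rw [map_smul, A₁v, smul_zero]
  -- A common zero `c` off the facet, scaled to `B = 1`, has the coordinates of `y₀` for `j ≠ 0` and
  -- of `y₁` for `j ≠ 1`. Every index is covered, so it serves as the apex over the facet.
  · left
    push Not at hs
    obtain ⟨c, hc, h0, h1, hBc⟩ := hs
    have hpos : 0 < B c := (hB c hc).lt_of_ne' hBc
    simp only [A₀, A₁, LinearMap.sum_apply, ap] at h0 h1
    have e0 : ∀ j, j ≠ 0 → f j c = B c * f j y₀ := fun j hj => sub_eq_zero.1 <|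
      (Finset.sum_eq_zero_iff_of_nonneg fun i hi => hf₀ i (Finset.ne_of_mem_erase hi) c hc).1 h0 j
        (Finset.mem_erase.2 ⟨hj, Finset.mem_univ _⟩)
    have e1 : ∀ j, j ≠ 1 → f j c = B c * f j y₁ := fun j hj => sub_eq_zero.1 <|
      (Finset.sum_eq_zero_iff_of_nonneg fun i hi => hf₁ i (Finset.ne_of_mem_erase hi) c hc).1 h1 j
        (Finset.mem_erase.2 ⟨hj, Finset.mem_univ _⟩)
    have hBq : B ((B c)⁻¹ • c) = 1 := by simp [hBc]
    refine IsSimplicialUpToLineality.of_facet (f := f) (F := fun j => f j - f j ((B c)⁻¹ • c) • B)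
      hv hBv hB (polyCone_smul (inv_nonneg.2 hpos.le) hc) hBq ?_ ?_ ?_ ?_
    · rintro x hx _ rfl
      refine hf _ (V.sub_mem hx.1 (V.smul_mem _ (V.smul_mem _ hc.1))) ?_
      rw [map_sub, map_smul, hBq, smul_eq_mul, mul_one, sub_self]
    · intro j x hx
      rw [ap]
      by_cases hj : j = 0
      · have hj1 : j ≠ 1 := by rw [hj]; simp
        have : f j ((B c)⁻¹ • c) = f j y₁ := by
          rw [map_smul, e1 j hj1, smul_eq_mul, inv_mul_cancel_left₀ hBc]
        rw [this]; exact hf₁ j hj1 x hx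
      · have : f j ((B c)⁻¹ • c) = f j y₀ := by
          rw [map_smul, e0 j hj, smul_eq_mul, inv_mul_cancel_left₀ hBc]
        rw [this]; exact hf₀ j hj x hx
    · intro i j
      rw [ap, hBv, zero_mul, sub_zero, hfv]
    · intro j
      rw [ap, hBq, one_mul, sub_self]

open Classical in
/-- Every polyhedral cone is simplicial (up to lineality) or contains a square. -/
theorem polyCone_isSimplicial_or_hasSquare (V : Submodule ℝ E) (s : Finset (Module.Dual ℝ E)) :
    IsSimplicialUpToLineality (polyCone V s) ∨ HasSquare (polyCone V s) := by
  induction s using Finset.strongInduction generalizing V with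
  | H s ih =>
  by_cases h1 : ∃ φ ∈ s, ∀ c ∈ polyCone V (s.erase φ), 0 ≤ φ c
  · obtain ⟨φ, hφ, h⟩ := h1
    have e : polyCone V s = polyCone V (s.erase φ) := by
      refine Set.Subset.antisymm
        (fun c hc => ⟨hc.1, fun ψ hψ => hc.2 ψ (Finset.mem_of_mem_erase hψ)⟩)
        (fun c hc => ⟨hc.1, fun ψ hψ => ?_⟩)
      by_cases e : ψ = φ
      · rw [e]; exact h c hc
      · exact hc.2 ψ (Finset.mem_erase.2 ⟨e, hψ⟩)
    rw [e]
    exact ih _ (Finset.erase_ssubset hφ) V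
  by_cases h2 : ∃ φ ∈ s, ∀ c ∈ polyCone V s, φ c = 0
  · obtain ⟨φ, hφ, h⟩ := h2
    have e : polyCone V s = polyCone (V ⊓ LinearMap.ker φ) (s.erase φ) :=
      Set.Subset.antisymm (fun c hc => mem_polyCone_face hc (h c hc))
        (fun c hc => (mem_polyCone_of_face hc).1)
    rw [e]
    exact ih _ (Finset.erase_ssubset hφ) _
  -- From here on no inequality is redundant and none is an implicit equation, so every `B ∈ s`
  -- defines a genuine facet.
  push Not at h1 h2
  rcases s.eq_empty_or_nonempty with rfl | ⟨B, hBs⟩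
  · left
    refine ⟨0, Fin.elim0, Fin.elim0, fun i => i.elim0, fun i => i.elim0, fun i => i.elim0, ?_⟩
    intro c hc
    refine ⟨⟨?_, by simp⟩, ⟨?_, by simp⟩⟩
    · simpa using hc.1
    · simpa using hc.1
  have hB : ∀ c ∈ polyCone V s, 0 ≤ B c := fun c hc => hc.2 B hBs
  obtain ⟨c₀, hc₀, hpos⟩ : ∃ c ∈ polyCone V s, ∀ φ ∈ s, 0 < φ c := by
    choose! c hc hne using h2
    refine ⟨∑ φ ∈ s, c φ, polyCone_sum hc, fun φ hφ => ?_⟩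
    rw [map_sum]
    exact Finset.sum_pos' (fun ψ hψ => (hc ψ hψ).2 φ hφ)
      ⟨φ, hφ, ((hc φ hφ).2 φ hφ).lt_of_ne' (hne φ hφ)⟩
  -- The segment from `c₀` to a point violating only `B` meets `ker B` in the relative interior of
  -- the facet; `g` is a multiple of that point.
  obtain ⟨g, hg, hBg, hgs⟩ : ∃ g ∈ V, B g = 0 ∧ ∀ φ ∈ s.erase B, 0 < φ g := by
    obtain ⟨q, hq, hBq⟩ := h1 B hBs
    refine ⟨B c₀ • q - B q • c₀, V.sub_mem (V.smul_mem _ hq.1) (V.smul_mem _ hc₀.1), ?_, ?_⟩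
    · simp only [map_sub, map_smul, smul_eq_mul]; ring
    · intro φ hφ
      have := hpos φ (Finset.mem_of_mem_erase hφ)
      have := hpos B hBs
      have := hq.2 φ hφ
      simp only [map_sub, map_smul, smul_eq_mul]
      nlinarith
  rcases ih _ (Finset.erase_ssubset hBs) (V ⊓ LinearMap.ker B) with hG | hG
  swap
  · exact Or.inr (hG.of_face hBs)
  obtain ⟨m, v, f, hv, hfG, hfv, hL⟩ := hG
  have hvC := fun i => (mem_polyCone_of_face (hv i)).1
  have hBv := fun i => (mem_polyCone_of_face (hv i)).2
  have hf : ∀ x ∈ V, B x = 0 → x - ∑ i, f i x • v i ∈ polyCone V s ∧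
      -(x - ∑ i, f i x • v i) ∈ polyCone V s := by
    intro x hx hBx
    obtain ⟨a, ha, b, hb, rfl⟩ :=
      sub_mem_polyCone_sub (V := V ⊓ LinearMap.ker B) ⟨hg, hBg⟩ hgs ⟨hx, hBx⟩
    have e : a - b - ∑ i, f i (a - b) • v i =
        (a - ∑ i, f i a • v i) + -(b - ∑ i, f i b • v i) := by
      simp only [map_sub, sub_smul, Finset.sum_sub_distrib]; abel
    have e' : -(a - b - ∑ i, f i (a - b) • v i) =
        -(a - ∑ i, f i a • v i) + (b - ∑ i, f i b • v i) := by
      rw [e]; abel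
    rw [e', e]
    exact ⟨(mem_polyCone_of_face (polyCone_add (hL a ha).1 (hL b hb).2)).1,
      (mem_polyCone_of_face (polyCone_add (hL a ha).2 (hL b hb).1)).1⟩
  have hy : (B c₀)⁻¹ • c₀ ∈ polyCone V s := polyCone_smul (inv_nonneg.2 (hpos B hBs).le) hc₀
  have hBy : B ((B c₀)⁻¹ • c₀) = 1 := by simp [(hpos B hBs).ne']
  have hex : ∀ i, ∃ φ ∈ s, 0 < φ (v i) := by
    intro i
    by_contra! hc
    have h0 : -v i ∈ polyCone V s :=
      ⟨V.neg_mem (hvC i).1, fun φ hφ => by rw [map_neg]; linarith [hc φ hφ]⟩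
    have := eq_zero_of_nonneg_of_neg_mem (hfG i) (hv i)
      (mem_polyCone_face h0 (by rw [map_neg, hBv, neg_zero]))
    rw [hfv, if_pos rfl] at this
    exact one_ne_zero this
  have sub_smul_mem : ∀ q ∈ polyCone V s, B q = 1 → ∀ c ∈ polyCone V s, ∀ x, x = c - B c • q →
      x - ∑ i, f i x • v i ∈ polyCone V s ∧ -(x - ∑ i, f i x • v i) ∈ polyCone V s := by
    rintro q hq hBq c hc _ rfl
    refine hf _ (V.sub_mem hc.1 (V.smul_mem _ hq.1)) ?_
    rw [map_sub, map_smul, hBq, smul_eq_mul, mul_one, sub_self]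
  rcases m with _ | _ | k
  · left
    exact .of_facet (f := f) (F := f) hvC hBv hB hy hBy (sub_smul_mem _ hy hBy)
      (fun i => i.elim0) (fun i => i.elim0) (fun i => i.elim0)
  · left
    -- Ratio test: moving from `y` against `v 0` until a first constraint `φ` becomes tight reaches
    -- the second ray, and `φ` is then the coordinate along `v 0`.
    obtain ⟨φ, hφ, hmin⟩ := (s.filter fun φ => 0 < φ (v 0)).exists_min_image
      (fun φ => φ ((B c₀)⁻¹ • c₀) / φ (v 0))
      (by obtain ⟨φ, hφ, h⟩ := hex 0; exact ⟨φ, Finset.mem_filter.2 ⟨hφ, h⟩⟩)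
    obtain ⟨hφs, hφv⟩ := Finset.mem_filter.1 hφ
    set y := (B c₀)⁻¹ • c₀
    have hq : y - (φ y / φ (v 0)) • v 0 ∈ polyCone V s := by
      refine ⟨V.sub_mem hy.1 (V.smul_mem _ (hvC 0).1), fun ψ hψ => ?_⟩
      rw [map_sub, map_smul ψ _ (v 0), smul_eq_mul]
      rcases ((hvC 0).2 ψ hψ).eq_or_lt with h0 | h0
      · rw [← h0, mul_zero, sub_zero]; exact hy.2 ψ hψ
      · have := (le_div_iff₀ h0).1 (hmin ψ (Finset.mem_filter.2 ⟨hψ, h0⟩))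
        linarith
    have hBq : B (y - (φ y / φ (v 0)) • v 0) = 1 := by simp [hBy, hBv]
    refine .of_facet (f := f) (F := fun _ => (φ (v 0))⁻¹ • φ) hvC hBv hB hq hBq
      (sub_smul_mem _ hq hBq) ?_ ?_ ?_
    · intro _ c hc
      exact mul_nonneg (inv_nonneg.2 hφv.le) (hc.2 φ hφs)
    · intro i j
      fin_cases i; fin_cases j
      simp [hφv.ne']
    · intro _
      simp [hφv.ne']
  · by_cases hsq : HasSquare (polyCone V s)
    · exact Or.inr hsq
    have hn : ∀ i, ∃ y ∈ polyCone V s, B y = 1 ∧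
        ∀ j, j ≠ i → ∀ c ∈ polyCone V s, 0 ≤ f j c - B c * f j y := by
      intro i
      have hss : (s.filter fun φ => φ (v i) = 0) ⊂ s := by
        obtain ⟨φ, hφ, h⟩ := hex i
        exact Finset.filter_ssubset.2 ⟨φ, hφ, h.ne'⟩
      obtain ⟨y, hy, hBy, H⟩ := exists_neighbor hBs (hvC i) (hBv i) hg hBg hgs hc₀ (hpos B hBs)
        ((ih _ hss V).resolve_right fun h => hsq (h.of_filter (hvC i)))
      refine ⟨y, hy, hBy, fun j hj c hc => ?_⟩
      -- The unknown shift `t • v i` is invisible to `f j`, as `f j (v i) = 0`.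
      obtain ⟨t, ht⟩ := H c hc
      have := hfG j _ ht
      simpa [hfv, hj] using this
    obtain ⟨y₀, hy₀, hB₀, H₀⟩ := hn 0
    obtain ⟨y₁, hy₁, hB₁, H₁⟩ := hn 1
    exact isSimplicial_or_hasSquare_of_neighbors hBs hvC hBv hfv hf hy₀ hy₁ hB₀ hB₁ H₀ H₁

end Polyhedral

/-! ### Second-order and semidefinite cones, and the theorem. -/

section Standard
variable {E F : Type*} [AddCommGroup E] [Module ℝ E] [AddCommGroup F] [Module ℝ F]
  {C : PointedCone ℝ E} {D : PointedCone ℝ F}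

theorem IsSimplicialUpToLineality.isSimplexCone (h : IsSimplicialUpToLineality (C : Set E))
    (hp : IsProperCone C) (hg : IsGeneratingCone C) : IsSimplexCone C := by
  obtain ⟨n, v, f, hv, hf, hd, hL⟩ := h
  have hsum : ∀ c ∈ C, c = ∑ i, f i c • v i := fun c hc =>
    sub_eq_zero.1 (hp _ (hL c hc).1 (hL c hc).2)
  have hli : LinearIndependent ℝ v := by
    rw [Fintype.linearIndependent_iff]
    intro a ha i
    have := congrArg (f i) ha
    simpa [hd] using this
  have hspan : ⊤ ≤ Submodule.span ℝ (Set.range v) := by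
    have hC : ∀ c ∈ C, c ∈ Submodule.span ℝ (Set.range v) := fun c hc => by
      rw [hsum c hc]
      exact Submodule.sum_mem _ fun i _ =>
        Submodule.smul_mem _ _ (Submodule.subset_span (Set.mem_range_self i))
    intro x _
    obtain ⟨y, hy, z, hz, rfl⟩ := hg x
    exact Submodule.sub_mem _ (hC y hy) (hC z hz)
  refine ⟨n, Module.Basis.mk hli hspan, le_antisymm (fun c hc => ?_) ?_⟩
  · rw [hsum c hc, Module.Basis.coe_mk]
    exact Submodule.sum_mem _ fun i _ => PointedCone.smul_mem _ (hf i c hc)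
      (PointedCone.subset_hull (Set.mem_range_self i))
  · rw [Module.Basis.coe_mk]
    exact Submodule.span_le.2 (Set.range_subset_iff.2 hv)

theorem IsPolyhedralCone.isSimplexCone_or_hasSquare (h : IsPolyhedralCone C)
    (hp : IsProperCone C) (hg : IsGeneratingCone C) :
    IsSimplexCone C ∨ HasSquare (C : Set E) := by
  obtain ⟨s, hs⟩ := h
  have e : (C : Set E) = polyCone ⊤ s := by
    ext x
    simp [polyCone, hs]
  rcases polyCone_isSimplicial_or_hasSquare ⊤ s with h | h <;> rw [← e] at h
  exacts [Or.inl (h.isSimplexCone hp hg), Or.inr h]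

theorem ConeIso.isPolyhedralCone (h : ConeIso C D) (hD : IsPolyhedralCone D) :
    IsPolyhedralCone C := by
  classical
  obtain ⟨e, he⟩ := h
  obtain ⟨s, hs⟩ := hD
  refine ⟨s.image fun φ => φ ∘ₗ e.toLinearMap, fun x => ?_⟩
  simp [he, hs]

theorem ConeIso.hasDisc (h : ConeIso C D) (hD : HasDisc (D : Set F)) : HasDisc (C : Set E) := by
  obtain ⟨e, he⟩ := h
  obtain ⟨e₀, e₁, e₂, T, X, Y, hT, hD, hd⟩ := hD
  refine ⟨e.symm e₀, e.symm e₁, e.symm e₂, T ∘ₗ e.toLinearMap, X ∘ₗ e.toLinearMap,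
    Y ∘ₗ e.toLinearMap, fun c hc => hT _ ((he c).1 hc), fun t a b ht hab => ?_, by simpa using hd⟩
  have := hD t a b ht hab
  refine (he _).2 ?_
  simpa using this

theorem lorentzCone_isPolyhedralCone_or_hasDisc (n : ℕ) :
    IsPolyhedralCone (lorentzCone n) ∨ HasDisc (lorentzCone n : Set (Fin (n + 1) → ℝ)) := by
  classical
  rcases n with _ | _ | n
  · left
    refine ⟨{(LinearMap.proj 0 : (Fin 1 → ℝ) →ₗ[ℝ] ℝ)}, fun x => ?_⟩
    change Real.sqrt _ ≤ _ ↔ _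
    simp
  · left
    refine ⟨{(LinearMap.proj 1 : (Fin 2 → ℝ) →ₗ[ℝ] ℝ) - LinearMap.proj 0,
      (LinearMap.proj 1 : (Fin 2 → ℝ) →ₗ[ℝ] ℝ) + LinearMap.proj 0}, fun x => ?_⟩
    change Real.sqrt _ ≤ _ ↔ _
    simp [Real.sqrt_sq_eq_abs, abs_le]
    constructor <;> rintro ⟨h1, h2⟩ <;> constructor <;> linarith
  · right
    have hl0 : (Fin.last (n + 2)) ≠ 0 := by simp [Fin.ext_iff]
    have hl1 : (Fin.last (n + 2)) ≠ 1 := by simp [Fin.ext_iff]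
    refine ⟨Pi.single (Fin.last _) 1, Pi.single 0 1, Pi.single 1 1, LinearMap.proj (Fin.last _),
      LinearMap.proj 0, LinearMap.proj 1, fun x hx => ?_, fun t a b ht hab => ?_, ?_⟩
    · change Real.sqrt _ ≤ _ at hx
      refine ⟨(Real.sqrt_nonneg _).trans hx, ?_⟩
      have h := (Real.sqrt_le_left ((Real.sqrt_nonneg _).trans hx)).1 hx
      refine le_trans ?_ h
      rw [Fin.sum_univ_succ, Fin.sum_univ_succ, ← add_assoc]
      refine le_add_of_le_of_nonneg le_rfl (Finset.sum_nonneg fun i _ => sq_nonneg _)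
    · change Real.sqrt _ ≤ _
      have e : (t • Pi.single (Fin.last (n + 2)) 1 + a • Pi.single 0 1 + b • Pi.single 1 1 :
          Fin (n + 3) → ℝ) (Fin.last (n + 2)) = t := by
        simp [hl0, hl1]
      have e' : ∑ i : Fin (n + 2), (t • Pi.single (Fin.last (n + 2)) 1 + a • Pi.single 0 1 +
          b • Pi.single 1 1 : Fin (n + 3) → ℝ) i.castSucc ^ 2 = a ^ 2 + b ^ 2 := by
        rw [Fin.sum_univ_succ, Fin.sum_univ_succ, Finset.sum_eq_zero, add_zero]
        · simp [Fin.ext_iff]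
        · intro i _
          have h3 : i.castSucc.succ.succ ≠ (1 : Fin (n + 3)) := by simp [Fin.ext_iff]
          simp [h3]
      rw [e, e']
      exact Real.sqrt_le_iff.2 ⟨ht, hab⟩
    · simp [hl0, hl1, hl0.symm, hl1.symm]

section Psd
variable (𝕜 : Type) [RCLike 𝕜]

/-- The real part of a matrix entry as a functional on self-adjoint matrices. -/
def reEntry (n : ℕ) (i j : Fin n) : Module.Dual ℝ (HermMatrix 𝕜 n) where
  toFun A := RCLike.re ((A : Matrix (Fin n) (Fin n) 𝕜) i j)
  map_add' A B := by simp
  map_smul' c A := by simp [RCLike.smul_re]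

theorem reEntry_apply {n : ℕ} (i j : Fin n) (A : HermMatrix 𝕜 n) :
    reEntry 𝕜 n i j A = RCLike.re ((A : Matrix (Fin n) (Fin n) 𝕜) i j) := rfl

/-- The self-adjoint matrix `E i j + E j i`. -/
def symUnit (n : ℕ) (i j : Fin n) : HermMatrix 𝕜 n :=
  ⟨Matrix.single i j 1 + Matrix.single j i 1, by
    change star _ = _
    simp [Matrix.star_eq_conjTranspose, add_comm]⟩

theorem smul_symUnit_mem_psdCone (n : ℕ) (i j : Fin n) (p q : ℝ) :
    (p ^ 2 / 2) • symUnit 𝕜 n i i + (p * q) • symUnit 𝕜 n i j + (q ^ 2 / 2) • symUnit 𝕜 n j j ∈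
      psdCone 𝕜 n := by
  classical
  have h := Matrix.posSemidef_vecMulVec_self_star
    (Pi.single i (p : 𝕜) + Pi.single j (q : 𝕜) : Fin n → 𝕜)
  change Matrix.PosSemidef (n := Fin n) (R := 𝕜) _
  convert! h using 1
  have e : ∀ (r s : ℝ) (k l : Fin n), Matrix.vecMulVec (Pi.single k (r : 𝕜))
      (star (Pi.single l (s : 𝕜))) = (r * s) • Matrix.single k l (1 : 𝕜) := by
    intro r s k l
    ext a b
    simp [Matrix.vecMulVec_apply, Matrix.single_apply, Pi.single_apply, RCLike.real_smul_eq_coe_mul]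
    split_ifs <;> simp_all
  rw [star_add, Matrix.add_vecMulVec, Matrix.vecMulVec_add, Matrix.vecMulVec_add, e, e, e, e]
  simp only [symUnit, Submodule.coe_add, Submodule.coe_smul]
  module

theorem psdCone_isPolyhedralCone_or_hasDisc (n : ℕ) :
    IsPolyhedralCone (psdCone 𝕜 n) ∨ HasDisc (psdCone 𝕜 n : Set (HermMatrix 𝕜 n)) := by
  classical
  rcases n with _ | _ | n
  · left
    refine ⟨∅, fun A => ?_⟩
    simp only [Finset.notMem_empty, false_imp_iff, implies_true, iff_true]
    have : A = 0 := by
      ext i; exact i.elim0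
    rw [this]
    exact zero_mem _
  · left
    refine ⟨{reEntry 𝕜 1 0 0}, fun A => ?_⟩
    simp only [Finset.mem_singleton, forall_eq, reEntry_apply]
    constructor
    · intro h
      exact (RCLike.nonneg_iff.1 (Matrix.PosSemidef.diag_nonneg h (i := 0))).1
    · intro h
      have hA : (A : Matrix (Fin 1) (Fin 1) 𝕜).IsHermitian := A.2
      have e : (A : Matrix (Fin 1) (Fin 1) 𝕜) =
          Matrix.diagonal fun i => (A : Matrix (Fin 1) (Fin 1) 𝕜) i i := by
        ext i j
        fin_cases i; fin_cases j
        rfl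
      change (A : Matrix (Fin 1) (Fin 1) 𝕜).PosSemidef
      rw [e, Matrix.posSemidef_diagonal_iff]
      intro i
      fin_cases i
      change 0 ≤ (A : Matrix (Fin 1) (Fin 1) 𝕜) 0 0
      rw [← hA.coe_re_apply_self 0]
      exact RCLike.ofReal_nonneg.2 h
  · right
    -- The disc is the real part of the leading 2 × 2 block, `[[T + X, Y], [Y, T - X]]`; its cone
    -- inequality comes from the nonnegative principal minor.
    set T := (1 / 2 : ℝ) • (reEntry 𝕜 (n + 2) 0 0 + reEntry 𝕜 (n + 2) 1 1) with hT
    set X := (1 / 2 : ℝ) • (reEntry 𝕜 (n + 2) 0 0 - reEntry 𝕜 (n + 2) 1 1) with hX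
    refine ⟨(1 / 2 : ℝ) • (symUnit 𝕜 _ 0 0 + symUnit 𝕜 _ 1 1),
      (1 / 2 : ℝ) • (symUnit 𝕜 _ 0 0 - symUnit 𝕜 _ 1 1), symUnit 𝕜 _ 0 1,
      T, X, reEntry 𝕜 _ 0 1, fun A hA => ?_, fun t a b ht hab => ?_, ?_⟩
    · have hA : (A : Matrix (Fin (n + 2)) (Fin (n + 2)) 𝕜).PosSemidef := hA
      have h0 := (RCLike.nonneg_iff.1 (hA.diag_nonneg (i := 0))).1
      have h1 := (RCLike.nonneg_iff.1 (hA.diag_nonneg (i := 1))).1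
      have hdet := (RCLike.nonneg_iff.1 (hA.submatrix ![0, 1]).det_nonneg).1
      rw [Matrix.det_fin_two] at hdet
      simp only [Matrix.submatrix_apply, Matrix.cons_val_zero, Matrix.cons_val_one] at hdet
      rw [← hA.isHermitian.apply 1 0, ← hA.isHermitian.coe_re_apply_self 0,
        ← hA.isHermitian.coe_re_apply_self 1, map_sub, RCLike.star_def, RCLike.mul_conj,
        ← RCLike.ofReal_mul, ← RCLike.ofReal_pow, RCLike.ofReal_re, RCLike.ofReal_re] at hdet
      have hre := RCLike.abs_re_le_norm ((A : Matrix (Fin (n + 2)) (Fin (n + 2)) 𝕜) 0 1)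
      have hre2 := pow_le_pow_left₀ (abs_nonneg _) hre 2
      rw [sq_abs] at hre2
      simp only [hT, hX, LinearMap.smul_apply, LinearMap.add_apply, LinearMap.sub_apply,
        reEntry_apply, smul_eq_mul]
      constructor
      · linarith
      · linarith
    · obtain ⟨ha1, ha2⟩ := (neg_le_and_le_of_sq_add_sq_le ⟨ht, hab⟩).1
      have hp : 0 ≤ t + a := by linarith
      have hbq : (b / Real.sqrt (t + a)) ^ 2 ≤ t - a := by
        rw [div_pow, Real.sq_sqrt hp]
        exact div_le_of_le_mul₀ hp (by linarith) (by linarith)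
      -- If `t + a = 0`, then `b = 0` and the quotient is `0` by convention. In general the block is
      -- a rank-one matrix plus a nonnegative last diagonal entry.
      have hpb : Real.sqrt (t + a) * (b / Real.sqrt (t + a)) = b := by
        rcases hp.eq_or_lt with h | h
        · have : b = 0 := by
            have : a = -t := by linarith
            rw [this] at hab
            nlinarith
          simp [this]
        · rw [mul_div_cancel₀ _ (Real.sqrt_pos.2 h).ne']
      have h := add_mem (smul_symUnit_mem_psdCone 𝕜 (n + 2) 0 1 (Real.sqrt (t + a))
          (b / Real.sqrt (t + a)))
        (smul_symUnit_mem_psdCone 𝕜 (n + 2) 0 1 0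
          (Real.sqrt (t - a - (b / Real.sqrt (t + a)) ^ 2)))
      rw [hpb, Real.sq_sqrt hp, Real.sq_sqrt (by linarith)] at h
      convert! h using 1
      module
    · have h10 : (1 : Fin (n + 2)) ≠ 0 := by simp
      simp [hT, hX, reEntry_apply, symUnit, h10, RCLike.smul_re]
      norm_num

end Psd

theorem IsStandardCone.cases (h : IsStandardCone C) (hp : IsProperCone C)
    (hg : IsGeneratingCone C) :
    IsSimplexCone C ∨ HasSquare (C : Set E) ∨ HasDisc (C : Set E) := by
  have of_iso : ∀ {G : Type} [AddCommGroup G] [Module ℝ G] {Q : PointedCone ℝ G}, ConeIso C Q →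
      IsPolyhedralCone Q ∨ HasDisc (Q : Set G) →
      IsSimplexCone C ∨ HasSquare (C : Set E) ∨ HasDisc (C : Set E) := by
    rintro G _ _ Q hi (hQ | hQ)
    · rcases (hi.isPolyhedralCone hQ).isSimplexCone_or_hasSquare hp hg with h | h
      exacts [Or.inl h, Or.inr (Or.inl h)]
    · exact Or.inr (Or.inr (hi.hasDisc hQ))
  rcases h with h | ⟨n, h⟩ | ⟨n, h⟩ | ⟨n, h⟩
  · rcases h.isSimplexCone_or_hasSquare hp hg with h | h
    exacts [Or.inl h, Or.inr (Or.inl h)]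
  · exact of_iso h (lorentzCone_isPolyhedralCone_or_hasDisc n)
  · exact of_iso h (psdCone_isPolyhedralCone_or_hasDisc ℝ n)
  · exact of_iso h (psdCone_isPolyhedralCone_or_hasDisc ℂ n)

theorem minTensorProduct_eq_max_of_isSimplexCone
    [FiniteDimensional ℝ F] [TopologicalSpace F] [IsTopologicalAddGroup F] [ContinuousSMul ℝ F]
    [T2Space F] (hC : IsSimplexCone C) (hD : IsClosed (D : Set F)) :
    PointedCone.minTensorProduct C D = PointedCone.maxTensorProduct C D := by
  -- Local convexity supplies the separation behind the bipolar theorem for `D`.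
  have : LocallyConvexSpace ℝ F :=
    (toEuclidean (E := F)).toHomeomorph.isInducing.locallyConvexSpace
      (f := (toEuclidean (E := F)).toLinearEquiv.toLinearMap)
  obtain ⟨n, b, hb⟩ := hC
  have hspan : Submodule.span ℝ (C : Set E) = ⊤ := by
    rw [eq_top_iff, ← b.span_eq]
    refine Submodule.span_mono ?_
    rw [hb]
    exact PointedCone.subset_hull
  exact PointedCone.minTensorProduct_eq_max_of_simplicial_generating_left C
    ⟨D, hD⟩ ⟨Set.range b, Set.finite_range b, b.linearIndependent.linearIndepOn_id, hb.symm⟩ hspan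

end Standard

theorem theoremE
    {E : Type*} [AddCommGroup E] [Module ℝ E] [FiniteDimensional ℝ E]
    [TopologicalSpace E] [IsTopologicalAddGroup E] [ContinuousSMul ℝ E] [T2Space E]
    {F : Type*} [AddCommGroup F] [Module ℝ F] [FiniteDimensional ℝ F]
    [TopologicalSpace F] [IsTopologicalAddGroup F] [ContinuousSMul ℝ F] [T2Space F]
    (C : PointedCone ℝ E) (D : PointedCone ℝ F)
    (hC_closed : IsClosed (C : Set E)) (hC_proper : IsProperCone C)
    (hC_gen : IsGeneratingCone C) (hC_std : IsStandardCone C)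
    (hD_closed : IsClosed (D : Set F)) (hD_proper : IsProperCone D)
    (hD_gen : IsGeneratingCone D) (hD_std : IsStandardCone D) :
    PointedCone.minTensorProduct C D = PointedCone.maxTensorProduct C D ↔
      IsSimplexCone C ∨ IsSimplexCone D := by
  constructor
  · intro h
    by_contra! hn
    have h' := minTensorProduct_eq_max_symm h
    rcases (hC_std.cases hC_proper hC_gen).resolve_left hn.1 with hC | hC <;>
      rcases (hD_std.cases hD_proper hD_gen).resolve_left hn.2 with hD | hD
    · exact minTensorProduct_ne_max_of_hasSquare hC hD h
    · exact minTensorProduct_ne_max_of_hasDisc_of_hasSquare hD hC h'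
    · exact minTensorProduct_ne_max_of_hasDisc_of_hasSquare hC hD h
    · exact minTensorProduct_ne_max_of_hasDisc hC hD h
  · rintro (h | h)
    · exact minTensorProduct_eq_max_of_isSimplexCone h hD_closed
    · exact minTensorProduct_eq_max_symm (minTensorProduct_eq_max_of_isSimplexCone h hC_closed)
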